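/- **Proposition.** Let $A=(a_{ij})$, $a_{ij}=\langle\alpha_i^\vee,\alpha_j\rangle$, be a symmetrizable generalized Cartan matrix with Dynkin diagram $X$. Fix a diagonal matrix $D$ with positive rational entries such that $DA$ is symmetric, equip the root lattice with the form $(\alpha_i,\alpha_j)=D_{ii}a_{ij}$, and put $|\alpha|^2=(\alpha,\alpha)$. Assume that $X$ is doubly-laced, i.e. for all $i\ne j$ with $a_{ij}\neq 0$ the pair $(a_{ij},a_{ji})$ is $(-1,-1)$ (a single edge), $(-2,-1)$ or $(-1,-2)$ (a double edge with one arrow), and at least one double edge occurs; assume also that the real roots of the Kac–Moody algebra $\mathfrak g(A)$ have exactly two lengths. Let $X_{\mathrm{short}}$ (resp. $X_{\mathrm{long}}$) be the subdiagram of $X$ formed by the simple roots of shortest (resp. longest) length. Let $\Sigma=\{\beta_1,\dots,\beta_m\}$ be a linearly independent $\pi$-system of $\mathfrak g(A)$, that is, a linearly independent finite set of distinct real roots such that $\beta_i-\beta_j$ is not a root of $\mathfrak g(A)$ for $i\ne j$, and let $Y$ be its Dynkin diagram, i.e. the diagram of the matrix $(\langle\beta_i^\vee,\beta_j\rangle)_{i,j}$,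 where $\beta_i^\vee$ is the coroot of $\beta_i$. A subdiagram is the diagram formed by a subset of the vertices together with all edges between them, up to relabelling of vertices. 1. If $X_{\mathrm{short}}$ is of type $A_1$, then $C_3$ is not a subdiagram of $Y$; if $X_{\mathrm{long}}$ is of type $A_1$, then $B_3$ is not a subdiagram of $Y$. 2. If $X_{\mathrm{short}}$ is of type $A_2$, then neither $C_5$ nor $HD_3^{(2)}$ is a subdiagram of $Y$. 3. If $X_{\mathrm{long}}$ is of type $A_2$, then neither $B_5$ nor $HC_2^{(1)}$ is a subdiagram of $Y$. Here, with double-edge arrows pointing towards the shorter root, $B_n$ is the chain $\circ-\cdots-\circ\Rightarrow\circ$ and $C_n$ the chain $\circ-\cdots-\circ\Leftarrow\circ$ on $n$ vertices, $HD_3^{(2)}$ is $\circ-\circ\Leftarrow\circ\Rightarrow\circ$, and $HC_2^{(1)}$ is $\circ-\circ\Rightarrow\circ\Leftarrow\circ$. -/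

import Mathlib

namespace KacMoody

/-! ### Generalized Cartan matrices, root lattice, Weyl group, real roots -/

/-- A generalized Cartan matrix with rows and columns indexed by the finite type `ι`;
`a i j` is the number `⟨α_i^∨, α_j⟩`.  It is identified with its Dynkin diagram, whose vertex
set is `ι`. -/
structure GCM (ι : Type*) where
  a : Matrix ι ι ℤ
  diag : ∀ i, a i i = 2
  nonpos : ∀ i j, i ≠ j → a i j ≤ 0
  zero_of_zero : ∀ i j, a j i = 0 → a i j = 0

/-- The root lattice `Q = ⨁ ℤ α_i`, in coordinates with respect to the simple roots. -/
abbrev RootLattice (ι : Type*) := ι → ℤ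

/-- The coroot lattice `Q^∨ = ⨁ ℤ α_i^∨`, in coordinates with respect to the simple coroots. -/
abbrev CorootLattice (ι : Type*) := ι → ℤ

/-- The simple root `α_i`. -/
def simpleRoot {ι : Type*} [DecidableEq ι] (i : ι) : RootLattice ι := Pi.single i 1

/-- The simple coroot `α_i^∨`. -/
def simpleCoroot {ι : Type*} [DecidableEq ι] (i : ι) : CorootLattice ι := Pi.single i 1

namespace GCM

variable {ι : Type*} [Fintype ι] [DecidableEq ι] (A : GCM ι)

/-- The pairing `Q^∨ × Q → ℤ` with `⟨α_i^∨, α_j⟩ = a i j`. -/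
noncomputable def pairing : CorootLattice ι →ₗ[ℤ] RootLattice ι →ₗ[ℤ] ℤ :=
  Matrix.toLinearMap₂' ℤ A.a

theorem pairing_simple (i j : ι) : A.pairing (simpleCoroot i) (simpleRoot j) = A.a i j := by
  simp [pairing, simpleCoroot, simpleRoot, Matrix.toLinearMap₂'_apply, Pi.single_apply]

/-- The simple reflection `s_i α = α - ⟨α_i^∨, α⟩ α_i` of the root lattice. -/
noncomputable def simpleReflection (i : ι) : RootLattice ι ≃ₗ[ℤ] RootLattice ι :=
  Module.reflection (x := simpleRoot i) (f := A.pairing (simpleCoroot i))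
    ((A.pairing_simple i i).trans (A.diag i))

/-- The simple reflection `s_i h = h - ⟨h, α_i⟩ α_i^∨` of the coroot lattice. -/
noncomputable def simpleCoreflection (i : ι) : CorootLattice ι ≃ₗ[ℤ] CorootLattice ι :=
  Module.reflection (x := simpleCoroot i) (f := A.pairing.flip (simpleRoot i))
    ((A.pairing_simple i i).trans (A.diag i))

/-- The Weyl group, generated by the simple reflections; it is recorded with its simultaneous
action on the root lattice (first component) and the coroot lattice (second component). -/
def weylGroup :
    Subgroup ((RootLattice ι ≃ₗ[ℤ] RootLattice ι) × (CorootLattice ι ≃ₗ[ℤ] CorootLattice ι)) :=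
  Subgroup.closure (Set.range fun i => (A.simpleReflection i, A.simpleCoreflection i))

/-- The real roots, i.e. the Weyl group orbits of the simple roots. -/
def realRoots : Set (RootLattice ι) :=
  {α | ∃ w ∈ A.weylGroup, ∃ i, α = w.1 (simpleRoot i)}

/-- `c` is the coroot `α^∨` of the real root `α`: if `α = w α_i` then `α^∨ = w α_i^∨`. -/
def IsCoroot (α : RootLattice ι) (c : CorootLattice ι) : Prop :=
  ∃ w ∈ A.weylGroup, ∃ i, α = w.1 (simpleRoot i) ∧ c = w.2 (simpleCoroot i)

open Classical in
/-- The coroot `α^∨` of a real root `α` (it does not depend on the way `α` is written as `w α_i`);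
junk value `0` if `α` is not a real root. -/
noncomputable def coroot (α : RootLattice ι) : CorootLattice ι :=
  if h : ∃ c, A.IsCoroot α c then h.choose else 0

/-- The type `M(Σ) = (⟨β_i^∨, β_j⟩)_{i,j}` of a family `Σ = (β_i)` of real roots. -/
noncomputable def typeOf {κ : Type*} (β : κ → RootLattice ι) : Matrix κ κ ℤ :=
  Matrix.of fun i j => A.pairing (A.coroot (β i)) (β j)

/-! ### Symmetrization and root lengths -/

/-- The diagonal matrix with diagonal `D` has positive rational entries and `D A` is symmetric. -/
def IsSymmetrizedBy (D : ι → ℚ) : Prop :=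
  (∀ i, 0 < D i) ∧ (Matrix.diagonal D * A.a.map (Int.cast : ℤ → ℚ)).IsSymm

/-- The form on the root lattice with `(α_i, α_j) = D_i a_ij`. -/
noncomputable def form (D : ι → ℚ) (α β : RootLattice ι) : ℚ :=
  ∑ i, ∑ j, (α i : ℚ) * (D i * (A.a i j : ℚ)) * (β j : ℚ)

/-- The squared length `|α|² = (α, α)`. -/
noncomputable def normSq (D : ι → ℚ) (α : RootLattice ι) : ℚ := A.form D α α

/-- There are exactly two real root lengths.  (Real roots have positive squared length, so lengths
and squared lengths are equally many.) -/
def HasExactlyTwoRootLengths (D : ι → ℚ) : Prop :=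
  (A.normSq D '' A.realRoots).ncard = 2

/-- The vertices of `X_short`: the simple roots of shortest length. -/
def shortVertices (D : ι → ℚ) : Set ι :=
  {p | ∀ i, A.normSq D (simpleRoot p) ≤ A.normSq D (simpleRoot i)}

/-- The vertices of `X_long`: the simple roots of longest length. -/
def longVertices (D : ι → ℚ) : Set ι :=
  {p | ∀ i, A.normSq D (simpleRoot i) ≤ A.normSq D (simpleRoot p)}

/-! ### Diagrams -/

/-- Vertices `i`, `j` are joined by a single edge. -/
def SingleEdge (i j : ι) : Prop := A.a i j = -1 ∧ A.a j i = -1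

/-- Vertices `i`, `j` are joined by a double edge with one arrow, pointing towards `i`. -/
def DoubleEdgeTowards (i j : ι) : Prop := A.a i j = -2 ∧ A.a j i = -1

/-- Every edge is a single edge or a double edge with an arrow in one direction, and there is at
least one double edge. -/
def DoublyLaced : Prop :=
  (∀ i j, i ≠ j → A.a i j ≠ 0 →
    A.SingleEdge i j ∨ A.DoubleEdgeTowards i j ∨ A.DoubleEdgeTowards j i) ∧
  ∃ i j, A.DoubleEdgeTowards i j

/-- The subdiagram of `A` on the vertex set `S` is (up to a bijection of the vertices) the
diagram with matrix `M`. -/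
def SubdiagramOnIsOfType (S : Set ι) {n : ℕ} (M : Matrix (Fin n) (Fin n) ℤ) : Prop :=
  ∃ e : Fin n ≃ S, ∀ i j, A.a (e i) (e j) = M i j

end GCM

/-- `M` occurs as a subdiagram of `N`: it is, up to relabelling, the diagram
formed by some subset of the vertices of `N` with all edges of `N` between them. -/
def IsSubdiagram {μ ν : Type*} (M : Matrix μ μ ℤ) (N : Matrix ν ν ℤ) : Prop :=
  ∃ f : μ ↪ ν, ∀ i j, N (f i) (f j) = M i j

/-! The named diagrams; always the entry `(i, j)` is `⟨α_i^∨, α_j⟩`, so that a double edge with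
arrow from `j` towards `i` (`α_i` shorter than `α_j`) has entries `-2` at `(i, j)` and `-1` at
`(j, i)`. -/

/-- `A₁`: one vertex. -/
def diagA1 : Matrix (Fin 1) (Fin 1) ℤ := !![2]

/-- `A₂`: `1 — 2`. -/
def diagA2 : Matrix (Fin 2) (Fin 2) ℤ := !![2, -1; -1, 2]

/-- `B₃`: `1 — 2 ⇒ 3`, with two long simple roots and one short one. -/
def diagB3 : Matrix (Fin 3) (Fin 3) ℤ :=
  !![ 2, -1,  0;
     -1,  2, -1;
      0, -2,  2]

/-- `C₃`: `1 — 2 ⇐ 3`, with two short simple roots and one long one. -/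
def diagC3 : Matrix (Fin 3) (Fin 3) ℤ :=
  !![ 2, -1,  0;
     -1,  2, -2;
      0, -1,  2]

/-- `B₅`: `1 — 2 — 3 — 4 ⇒ 5`, with four long simple roots and one short one. -/
def diagB5 : Matrix (Fin 5) (Fin 5) ℤ :=
  !![ 2, -1,  0,  0,  0;
     -1,  2, -1,  0,  0;
      0, -1,  2, -1,  0;
      0,  0, -1,  2, -1;
      0,  0,  0, -2,  2]

/-- `C₅`: `1 — 2 — 3 — 4 ⇐ 5`, with four short simple roots and one long one. -/
def diagC5 : Matrix (Fin 5) (Fin 5) ℤ :=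
  !![ 2, -1,  0,  0,  0;
     -1,  2, -1,  0,  0;
      0, -1,  2, -1,  0;
      0,  0, -1,  2, -2;
      0,  0,  0, -1,  2]

/-- `HD₃⁽²⁾`: `1 — 2 ⇐ 3 ⇒ 4`. -/
def diagHD3_2 : Matrix (Fin 4) (Fin 4) ℤ :=
  !![ 2, -1,  0,  0;
     -1,  2, -2,  0;
      0, -1,  2, -1;
      0,  0, -2,  2]

/-- `HC₂⁽¹⁾`: `1 — 2 ⇒ 3 ⇐ 4`. -/
def diagHC2_1 : Matrix (Fin 4) (Fin 4) ℤ :=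
  !![ 2, -1,  0,  0;
     -1,  2, -1,  0;
      0, -2,  2, -2;
      0,  0, -1,  2]

/-! ### The Kac-Moody algebra and its roots -/

/-- A realization of `A`: a complex vector space `𝔥` of dimension `2n - rank A` with linearly
independent simple roots `α_i ∈ 𝔥*` and linearly independent simple coroots `α_i^∨ ∈ 𝔥` such that
`⟨α_i^∨, α_j⟩ = a i j`. -/
structure Realization {ι : Type*} [Fintype ι] (A : GCM ι)
    (𝔥 : Type*) [AddCommGroup 𝔥] [Module ℂ 𝔥] where
  root : ι → Module.Dual ℂ 𝔥
  coroot : ι → 𝔥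
  finiteDimensional : FiniteDimensional ℂ 𝔥
  finrank_add_rank :
    Module.finrank ℂ 𝔥 + (A.a.map (Int.cast : ℤ → ℂ)).rank = 2 * Fintype.card ι
  linearIndependent_root : LinearIndependent ℂ root
  linearIndependent_coroot : LinearIndependent ℂ coroot
  root_coroot : ∀ i j, root j (coroot i) = (A.a i j : ℂ)

/-- The kernel of `A` over `ℂ`. -/
noncomputable abbrev kernel {ι : Type*} [Fintype ι] (A : GCM ι) : Submodule ℂ (ι → ℂ) := LinearMap.ker (A.a.map (Int.cast : ℤ → ℂ)).mulVecLin

/-- Every generalized Cartan matrix has a realization. -/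
theorem exists_realization {ι : Type*} [Fintype ι] [DecidableEq ι] (A : GCM ι) :
    Nonempty (Realization A ((ι → ℂ) × Module.Dual ℂ (kernel A))) := by
  obtain ⟨p, hp⟩ := LinearMap.exists_leftInverse_of_injective (kernel A).subtype (Submodule.ker_subtype _)
  have hp' : ∀ x : kernel A, p x = x := fun x => LinearMap.congr_fun hp x
  refine ⟨{
    root := fun j => LinearMap.coprod
      ((LinearMap.proj j) ∘ₗ ((A.a.map (Int.cast : ℤ → ℂ)).vecMulLinear))
      (Module.Dual.eval ℂ _ (p (Pi.single j 1)))
    coroot := fun i => (Pi.single i 1, 0)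
    finiteDimensional := inferInstance
    finrank_add_rank := ?_
    linearIndependent_root := ?_
    linearIndependent_coroot := ?_
    root_coroot := ?_ }⟩
  · have := LinearMap.finrank_range_add_finrank_ker (A.a.map (Int.cast : ℤ → ℂ)).mulVecLin
    rw [Module.finrank_prod, Subspace.dual_finrank_eq, Module.finrank_fintype_fun_eq_card]
    rw [Module.finrank_fintype_fun_eq_card] at this
    have e : Module.finrank ℂ (kernel A) = Module.finrank ℂ (LinearMap.ker (A.a.map (Int.cast : ℤ → ℂ)).mulVecLin) := rfl
    rw [Matrix.rank, e]
    omega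
  · rw [Fintype.linearIndependent_iff]
    intro c hc
    have h1 : c ∈ kernel A := by
      rw [LinearMap.mem_ker]
      ext i
      have := LinearMap.congr_fun hc (Pi.single i 1, 0)
      simpa [Matrix.mulVec, dotProduct, mul_comm] using this
    have h2 : ∑ j, c j • p (Pi.single j 1) = p c := by
      simp only [← map_smul, ← map_sum]
      congr 1
      ext i
      simp [Pi.single_apply]
    have h3 : p c = 0 := by
      rw [← Module.forall_dual_apply_eq_zero_iff ℂ]
      intro φ
      rw [← h2]
      have := LinearMap.congr_fun hc (0, φ)
      simpa using this
    have := hp' ⟨c, h1⟩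
    rw [h3] at this
    intro i
    have h4 := congrArg Subtype.val this
    exact (congrFun h4 i).symm
  · rw [Fintype.linearIndependent_iff]
    intro c hc i
    have := congrArg (fun z => z.1 i) hc
    simpa [Prod.fst_sum, Pi.single_apply] using this
  · intro i j
    simp

/-- Generators `e_i`, `f_i` and `h ∈ 𝔥`. -/
inductive Generator (ι 𝔥 : Type*)
  | e : ι → Generator ι 𝔥
  | f : ι → Generator ι 𝔥
  | h : 𝔥 → Generator ι 𝔥

namespace Realization

variable {ι : Type*} [Fintype ι] {A : GCM ι} {𝔥 : Type*} [AddCommGroup 𝔥] [Module ℂ 𝔥]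
  (R : Realization A 𝔥)

/-- The generator `e_i` of the free Lie algebra. -/
noncomputable abbrev genE (_R : Realization A 𝔥) (i : ι) : FreeLieAlgebra ℂ (Generator ι 𝔥) :=
  FreeLieAlgebra.of ℂ (.e i)

/-- The generator `f_i` of the free Lie algebra. -/
noncomputable abbrev genF (_R : Realization A 𝔥) (i : ι) : FreeLieAlgebra ℂ (Generator ι 𝔥) :=
  FreeLieAlgebra.of ℂ (.f i)

/-- The generator of the free Lie algebra given by `x ∈ 𝔥`. -/
noncomputable abbrev genH (_R : Realization A 𝔥) (x : 𝔥) : FreeLieAlgebra ℂ (Generator ι 𝔥) :=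
  FreeLieAlgebra.of ℂ (.h x)

/-- The defining relations of the auxiliary Lie algebra, as elements that become zero: `𝔥` is
embedded linearly and is abelian, `[e_i, f_j] = δ_ij α_i^∨`, `[h, e_i] = α_i(h) e_i` and
`[h, f_i] = -α_i(h) f_i`. -/
inductive Relator : FreeLieAlgebra ℂ (Generator ι 𝔥) → Prop
  | add (x y : 𝔥) : Relator (R.genH (x + y) - R.genH x - R.genH y)
  | smul (c : ℂ) (x : 𝔥) : Relator (R.genH (c • x) - c • R.genH x)
  | hh (x y : 𝔥) : Relator ⁅R.genH x, R.genH y⁆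
  | ef_same (i : ι) : Relator (⁅R.genE i, R.genF i⁆ - R.genH (R.coroot i))
  | ef_ne (i j : ι) (hij : i ≠ j) : Relator ⁅R.genE i, R.genF j⁆
  | he (x : 𝔥) (i : ι) : Relator (⁅R.genH x, R.genE i⁆ - R.root i x • R.genE i)
  | hf (x : 𝔥) (i : ι) : Relator (⁅R.genH x, R.genF i⁆ + R.root i x • R.genF i)

/-- The auxiliary Lie algebra `𝔤̃(A)`. -/
noncomputable abbrev AuxAlgebra : Type _ :=
  FreeLieAlgebra ℂ (Generator ι 𝔥) ⧸
    LieSubmodule.lieSpan ℂ (FreeLieAlgebra ℂ (Generator ι 𝔥)) {x | R.Relator x}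

/-- The image of `h ∈ 𝔥` in `𝔤̃(A)`. -/
noncomputable def auxCartan (x : 𝔥) : R.AuxAlgebra := LieSubmodule.Quotient.mk (R.genH x)

/-- The largest ideal of `𝔤̃(A)` that meets `𝔥` trivially. -/
noncomputable def radical : LieIdeal ℂ R.AuxAlgebra :=
  sSup {I | ∀ x : 𝔥, R.auxCartan x ∈ I → R.auxCartan x = 0}

/-- The Kac-Moody algebra `𝔤(A)`. -/
noncomputable abbrev KMAlgebra : Type _ := R.AuxAlgebra ⧸ R.radical

/-- The image of `h ∈ 𝔥` in `𝔤(A)`. -/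
noncomputable def cartan (x : 𝔥) : R.KMAlgebra := LieSubmodule.Quotient.mk (R.auxCartan x)

/-- The element of `𝔥*` given by an element of the root lattice. -/
noncomputable def weight (α : RootLattice ι) : Module.Dual ℂ 𝔥 := ∑ i, (α i : ℂ) • R.root i

/-- `α` is a root of `𝔤(A)`: it is nonzero and its root space is nonzero. -/
def IsRoot (α : RootLattice ι) : Prop :=
  α ≠ 0 ∧ ∃ x : R.KMAlgebra, x ≠ 0 ∧ ∀ t : 𝔥, ⁅R.cartan t, x⁆ = R.weight α t • x

/-- A π-system: a finite family of distinct real roots whose pairwise differences are not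
roots. -/
structure IsPiSystem [DecidableEq ι] {κ : Type*} (β : κ → RootLattice ι) : Prop where
  finite : Finite κ
  injective : Function.Injective β
  real : ∀ i, β i ∈ A.realRoots
  sub_not_root : ∀ i j, i ≠ j → ¬ R.IsRoot (β i - β j)

end Realization

end KacMoody

namespace KacMoody

namespace GCM

variable {ι : Type*} [Fintype ι] [DecidableEq ι] (A : GCM ι)

/-! The numbers `D i` take exactly two values, `d` and `2 * d`. Under the identification of roots
with coroots given by `D`, a short real root has even coroot coordinates at long simple roots, and a
long real root has even coordinates at short simple roots. Hence the pairing of two real roots of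
equal length, read modulo 2, is the Cartan form of `X_short` or `X_long` in the coordinates at the
simple roots of that length (`pairing_mod_two`).

Since the diagonal entries 2 vanish, this form is alternating over `ZMod 2`. For `A₁` it is zero, so
no single edge joins two roots of that length; `C₃` and `B₃` contain one. For `A₂` it is the
determinant on a plane, so the three-term Plücker relation holds (`pairing_pluecker`). It excludes
the `A₄` chain of equal-length roots in `C₅` and `B₅`, and, because no real root of that length
reduces to zero, also an edge with a third root orthogonal to both ends, as in `HD₃⁽²⁾` and
`HC₂⁽¹⁾`. -/

/-! ### Reflections and invariance of the pairing -/

theorem pairing_apply (c : CorootLattice ι) (b : RootLattice ι) :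
    A.pairing c b = ∑ i, ∑ j, c i * A.a i j * b j := by
  simp [pairing, Matrix.toLinearMap₂'_apply, _root_.mul_comm, mul_left_comm]

theorem pairing_simpleCoroot (k : ι) (b : RootLattice ι) :
    A.pairing (simpleCoroot k) b = ∑ j, A.a k j * b j := by
  rw [pairing_apply, Finset.sum_eq_single k]
  · simp [simpleCoroot]
  · intro i _ hi
    simp [simpleCoroot, hi]
  · simp

theorem pairing_simpleRoot (k : ι) (c : CorootLattice ι) :
    A.pairing c (simpleRoot k) = ∑ i, c i * A.a i k := by
  rw [pairing_apply]
  refine Finset.sum_congr rfl fun i _ => ?_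
  rw [Finset.sum_eq_single k]
  · simp [simpleRoot]
  · intro j _ hj
    simp [simpleRoot, hj]
  · simp

theorem simpleReflection_apply (k : ι) (b : RootLattice ι) :
    A.simpleReflection k b = b - A.pairing (simpleCoroot k) b • simpleRoot k :=
  Module.reflection_apply _ _

theorem simpleCoreflection_apply (k : ι) (c : CorootLattice ι) :
    A.simpleCoreflection k c = c - A.pairing c (simpleRoot k) • simpleCoroot k :=
  Module.reflection_apply _ _

theorem simpleReflection_simpleReflection (k : ι) (b : RootLattice ι) :
    A.simpleReflection k (A.simpleReflection k b) = b :=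
  Module.involutive_reflection _ b

theorem simpleCoreflection_simpleCoreflection (k : ι) (c : CorootLattice ι) :
    A.simpleCoreflection k (A.simpleCoreflection k c) = c :=
  Module.involutive_reflection _ c

/-- The pairing is invariant under the Weyl group. -/
theorem pairing_weylGroup
    {w : (RootLattice ι ≃ₗ[ℤ] RootLattice ι) × (CorootLattice ι ≃ₗ[ℤ] CorootLattice ι)}
    (hw : w ∈ A.weylGroup) (c : CorootLattice ι) (b : RootLattice ι) :
    A.pairing (w.2 c) (w.1 b) = A.pairing c b := by
  induction hw using Subgroup.closure_induction generalizing c b with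
  | mem x hx =>
    obtain ⟨k, rfl⟩ := hx
    simp only [simpleReflection_apply, simpleCoreflection_apply, map_sub, map_smul,
      LinearMap.sub_apply, LinearMap.smul_apply, pairing_simple, A.diag, smul_eq_mul]
    ring
  | one => rfl
  | mul x y _ _ hx hy => exact (hx _ _).trans (hy _ _)
  | inv x _ hx =>
    rw [← hx]
    congr 1
    · exact congrArg _ (x.2.apply_symm_apply c)
    · exact x.1.apply_symm_apply b

/-! ### Comparison of roots and coroots through the symmetrization -/

variable {D : ι → ℚ}

theorem IsSymmetrizedBy.mul_comm {A : GCM ι} (hD : A.IsSymmetrizedBy D) (i j : ι) :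
    D i * A.a i j = D j * A.a j i := by
  have h := hD.2.apply j i
  simpa [Matrix.diagonal_mul] using h

/-- `c` corresponds to `b` under the identification of root and coroot lattices over `ℚ` given by
the symmetrization `D`, up to the scalar `r`. -/
def Proportional (D : ι → ℚ) (r : ℚ) (b : RootLattice ι) (c : CorootLattice ι) : Prop :=
  ∀ i, (c i : ℚ) * r = b i * D i

theorem Proportional.pairing {A : GCM ι} {r : ℚ} {b : RootLattice ι}
    {c : CorootLattice ι} (h : Proportional D r b c) (b' : RootLattice ι) :
    r * A.pairing c b' = A.form D b b' := by
  rw [pairing_apply, form]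
  push_cast
  rw [Finset.mul_sum]
  refine Finset.sum_congr rfl fun i _ => ?_
  rw [Finset.mul_sum]
  refine Finset.sum_congr rfl fun j _ => ?_
  linear_combination (A.a i j * b' j : ℚ) * h i

theorem form_comm {A : GCM ι} (hD : A.IsSymmetrizedBy D) (b b' : RootLattice ι) :
    A.form D b b' = A.form D b' b := by
  rw [form, Finset.sum_comm, form]
  refine Finset.sum_congr rfl fun j _ => Finset.sum_congr rfl fun i _ => ?_
  rw [hD.mul_comm i j]
  ring

omit [Fintype ι] in
theorem proportional_simple (k : ι) :
    Proportional D (D k) (simpleRoot k) (simpleCoroot k) := by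
  intro i
  by_cases h : i = k
  · subst h
    simp [simpleRoot, simpleCoroot]
  · simp [simpleRoot, simpleCoroot, h]

theorem Proportional.simpleReflection {A : GCM ι} (hD : A.IsSymmetrizedBy D) {r : ℚ}
    {b : RootLattice ι} {c : CorootLattice ι} (h : Proportional D r b c) (k : ι) :
    Proportional D r (A.simpleReflection k b) (A.simpleCoreflection k c) := by
  -- Both sides equal the form of `b` with the simple root, so the two reflections subtract matching
  -- multiples.
  have key : r * A.pairing c (simpleRoot k) = D k * A.pairing (simpleCoroot k) b := by
    rw [h.pairing, form_comm hD, (proportional_simple k).pairing]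
  intro i
  have hi := proportional_simple (D := D) k i
  by_cases hik : i = k
  · subst hik
    simp only [simpleReflection_apply, simpleCoreflection_apply, Pi.sub_apply, Pi.smul_apply,
      smul_eq_mul, simpleRoot, simpleCoroot, Pi.single_eq_same] at key ⊢
    push_cast
    linear_combination h i - key
  · simpa [simpleReflection_apply, simpleCoreflection_apply, simpleRoot, simpleCoroot, hik]
      using h i

/-- The equivalence, rather than one implication, is what passes to inverses in the closure
induction; for generators the converse follows from involutivity. -/
theorem proportional_weylGroup_iff {A : GCM ι} (hD : A.IsSymmetrizedBy D) {r : ℚ}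
    {w : (RootLattice ι ≃ₗ[ℤ] RootLattice ι) × (CorootLattice ι ≃ₗ[ℤ] CorootLattice ι)}
    (hw : w ∈ A.weylGroup) (b : RootLattice ι) (c : CorootLattice ι) :
    Proportional D r (w.1 b) (w.2 c) ↔ Proportional D r b c := by
  induction hw using Subgroup.closure_induction generalizing c b with
  | mem x hx =>
    obtain ⟨k, rfl⟩ := hx
    refine ⟨fun h => ?_, fun h => h.simpleReflection hD k⟩
    have h' := h.simpleReflection hD k
    rwa [simpleReflection_simpleReflection, simpleCoreflection_simpleCoreflection] at h'
  | one => rfl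
  | mul x y _ _ hx hy => exact (hx _ _).trans (hy _ _)
  | inv x _ hx =>
    rw [← hx]
    exact iff_of_eq (congrArg₂ _ (x.1.apply_symm_apply b) (x.2.apply_symm_apply c))

/-- `b` is a real root in the orbit of a simple root `α_k` with `D k = r`, and `c` is its
coroot. -/
def IsRootPair (A : GCM ι) (D : ι → ℚ) (r : ℚ) (b : RootLattice ι) (c : CorootLattice ι) : Prop :=
  ∃ w ∈ A.weylGroup, ∃ k, D k = r ∧ b = w.1 (simpleRoot k) ∧ c = w.2 (simpleCoroot k)

theorem IsRootPair.proportional {A : GCM ι} (hD : A.IsSymmetrizedBy D) {r : ℚ}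
    {b : RootLattice ι} {c : CorootLattice ι} (h : A.IsRootPair D r b c) :
    Proportional D r b c := by
  obtain ⟨w, hw, k, rfl, rfl, rfl⟩ := h
  exact (proportional_weylGroup_iff hD hw _ _).2 (proportional_simple k)

/-- The index `k` comes from the Weyl group expression behind the chosen coroot, so independence of
that choice is not needed. -/
theorem exists_isRootPair_coroot {β : RootLattice ι} (hβ : β ∈ A.realRoots) :
    ∃ k, A.IsRootPair D (D k) β (A.coroot β) := by
  have h : ∃ c, A.IsCoroot β c := by
    obtain ⟨w, hw, i, hi⟩ := hβ
    exact ⟨_, w, hw, i, hi, rfl⟩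
  have hc : A.IsCoroot β (A.coroot β) := by
    rw [coroot, dif_pos h]
    exact h.choose_spec
  obtain ⟨w, hw, k, hb, hc⟩ := hc
  exact ⟨k, w, hw, k, rfl, hb, hc⟩

theorem IsRootPair.mul_pairing_comm {A : GCM ι} (hD : A.IsSymmetrizedBy D) {r r' : ℚ}
    {b b' : RootLattice ι} {c c' : CorootLattice ι} (h : A.IsRootPair D r b c)
    (h' : A.IsRootPair D r' b' c') :
    r * A.pairing c b' = r' * A.pairing c' b := by
  rw [(h.proportional hD).pairing, (h'.proportional hD).pairing, form_comm hD]

/-! ### Root lengths -/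

theorem normSq_simpleRoot (i : ι) : A.normSq D (simpleRoot i) = 2 * D i := by
  rw [normSq, form, Finset.sum_eq_single i]
  · rw [Finset.sum_eq_single i]
    · simp [simpleRoot, A.diag, _root_.mul_comm]
    · intro j _ hj
      simp [simpleRoot, hj]
    · simp
  · intro j _ hj
    simp [simpleRoot, hj]
  · simp

theorem simpleRoot_mem_realRoots (i : ι) : simpleRoot i ∈ A.realRoots :=
  ⟨1, one_mem _, i, rfl⟩

/-- A doubly-laced diagram with two root lengths has `D i ∈ {d, 2d}`, both values occurring. -/
theorem exists_symmetrizer_values {A : GCM ι} (hD : A.IsSymmetrizedBy D) (hlaced : A.DoublyLaced)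
    (htwo : A.HasExactlyTwoRootLengths D) :
    ∃ d : ℚ, 0 < d ∧ (∃ i, D i = d) ∧ (∃ i, D i = 2 * d) ∧ ∀ i, D i = d ∨ D i = 2 * d := by
  obtain ⟨i, j, hij, hji⟩ := hlaced.2
  have hpos := hD.1 i
  have hj : D j = 2 * D i := by
    have h := hD.mul_comm i j
    rw [hij, hji] at h
    push_cast at h
    linarith
  refine ⟨D i, hpos, ⟨i, rfl⟩, ⟨j, hj⟩, fun k => ?_⟩
  obtain ⟨x, y, -, hxy⟩ := Set.ncard_eq_two.1 htwo
  have hmem : ∀ l, 2 * D l = x ∨ 2 * D l = y := fun l => by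
    have h : A.normSq D (simpleRoot l) ∈ A.normSq D '' A.realRoots :=
      ⟨_, A.simpleRoot_mem_realRoots l, rfl⟩
    rwa [hxy, normSq_simpleRoot] at h
  -- As `D j = 2 * D i` differs from `D i`, the two lengths `x`, `y` are those of `i` and `j`, and
  -- `k` has one of them.
  rcases hmem i with hi | hi <;> rcases hmem j with hj' | hj' <;> rcases hmem k with hk | hk <;>
    first
    | (left; linarith)
    | (right; linarith)

theorem mem_shortVertices_iff {d : ℚ} (hpos : 0 < d) (hex : ∃ i, D i = d)
    (hval : ∀ i, D i = d ∨ D i = 2 * d) (p : ι) : p ∈ A.shortVertices D ↔ D p = d := by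
  simp only [shortVertices, Set.mem_ofPred_eq, normSq_simpleRoot]
  obtain ⟨i, hi⟩ := hex
  constructor
  · intro h
    have := h i
    rcases hval p with hp | hp <;> linarith
  · intro hp j
    rcases hval j with hj | hj <;> linarith

theorem mem_longVertices_iff {d : ℚ} (hpos : 0 < d) (hex : ∃ i, D i = 2 * d)
    (hval : ∀ i, D i = d ∨ D i = 2 * d) (p : ι) : p ∈ A.longVertices D ↔ D p = 2 * d := by
  simp only [longVertices, Set.mem_ofPred_eq, normSq_simpleRoot]
  obtain ⟨i, hi⟩ := hex
  constructor
  · intro h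
    have := h i
    rcases hval p with hp | hp <;> linarith
  · intro hp j
    rcases hval j with hj | hj <;> linarith

/-! ### Reduction modulo 2 -/

/-- For two roots of the same length, the simple roots of the other length do not contribute to
the pairing modulo `2`. -/
theorem even_pairing_term {A : GCM ι} (hD : A.IsSymmetrizedBy D) {d : ℚ} (hpos : 0 < d)
    (hval : ∀ i, D i = d ∨ D i = 2 * d) {r : ℚ} (hr : r = d ∨ r = 2 * d)
    {b' : RootLattice ι} {b : RootLattice ι} {c c' : CorootLattice ι}
    (h : Proportional D r b c) (h' : Proportional D r b' c') {i j : ι}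
    (hij : ¬ (D i = r ∧ D j = r)) : Even (c i * A.a i j * b' j) := by
  have hd := hpos.ne'
  have twice : ∀ {x y : ℤ}, (x : ℚ) * d = y * (2 * d) → Even x := fun {x y} hxy => by
    refine even_iff_two_dvd.2 ⟨y, ?_⟩
    have : (x : ℚ) = 2 * y := mul_right_cancel₀ hd (by linarith)
    exact_mod_cast this
  have entry : ∀ {k l}, D k = d → D l = 2 * d → Even (A.a k l) := fun {k l} hk hl => by
    have hs := hD.mul_comm k l
    rw [hk, hl] at hs
    exact twice (y := A.a l k) (by linarith)
  have hc := h i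
  have hb := h' j
  -- For `r = d` a long `i` makes `c i` even; for `r = 2 * d` a short `j` makes `b' j` even. With
  -- `i` short and `j` long the Cartan entry is even.
  rcases hr with rfl | rfl <;> rcases hval i with hi | hi <;> rcases hval j with hj | hj
  · exact absurd ⟨hi, hj⟩ hij
  · exact ((entry hi hj).mul_left _).mul_right _
  · rw [hi] at hc
    exact ((twice hc).mul_right _).mul_right _
  · rw [hi] at hc
    exact ((twice hc).mul_right _).mul_right _
  · rw [hj] at hb
    exact (twice hb.symm).mul_left _
  · exact ((entry hi hj).mul_left _).mul_right _
  · rw [hj] at hb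
    exact (twice hb.symm).mul_left _
  · exact absurd ⟨hi, hj⟩ hij

/-- The vertices with `D k = r` form a diagram with matrix `M`, embedded by `e`. -/
structure IsLengthDiagram (A : GCM ι) (D : ι → ℚ) (r : ℚ) {n : ℕ} (M : Matrix (Fin n) (Fin n) ℤ)
    (e : Fin n → ι) : Prop where
  injective : Function.Injective e
  mem_range_iff : ∀ k, k ∈ Set.range e ↔ D k = r
  entry : ∀ s t, A.a (e s) (e t) = M s t

omit [Fintype ι] [DecidableEq ι] in
theorem SubdiagramOnIsOfType.exists_isLengthDiagram {A : GCM ι} {r : ℚ} {S : Set ι} {n : ℕ}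
    {M : Matrix (Fin n) (Fin n) ℤ} (h : A.SubdiagramOnIsOfType S M) (hS : ∀ k, k ∈ S ↔ D k = r) :
    ∃ e : Fin n → ι, A.IsLengthDiagram D r M e := by
  obtain ⟨e, he⟩ := h
  refine ⟨fun s => e s, Subtype.val_injective.comp e.injective, fun k => ?_, he⟩
  rw [← hS]
  constructor
  · rintro ⟨s, rfl⟩
    exact (e s).2
  · intro hk
    exact ⟨e.symm ⟨k, hk⟩, by simp⟩

/-- Modulo `2`, the pairing of roots of the same length only depends on the coordinates of the
roots at the simple roots of this length. -/
theorem pairing_mod_two {A : GCM ι} (hD : A.IsSymmetrizedBy D) {d : ℚ} (hpos : 0 < d)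
    (hval : ∀ i, D i = d ∨ D i = 2 * d) {r : ℚ} (hr : r = d ∨ r = 2 * d)
    {n : ℕ} {M : Matrix (Fin n) (Fin n) ℤ} {e : Fin n → ι} (he : A.IsLengthDiagram D r M e)
    {b b' : RootLattice ι} {c c' : CorootLattice ι}
    (h : A.IsRootPair D r b c) (h' : A.IsRootPair D r b' c') :
    (A.pairing c b' : ZMod 2) = ∑ s, ∑ t, (b (e s) : ZMod 2) * M s t * b' (e t) := by
  have hb := h.proportional hD
  have hb' := h'.proportional hD
  have hzero : ∀ i j, ¬ (D i = r ∧ D j = r) →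
      (c i : ZMod 2) * (A.a i j : ZMod 2) * (b' j : ZMod 2) = 0 := fun i j hij => by
    have hev := even_pairing_term hD hpos hval hr hb hb' hij
    have := (ZMod.intCast_zmod_eq_zero_iff_dvd _ 2).2 (even_iff_two_dvd.1 hev)
    exact_mod_cast this
  -- At vertices with `D i = r` the proportionality factor cancels.
  have hcoord : ∀ s, c (e s) = b (e s) := fun s => by
    have hs := hb (e s)
    rw [(he.mem_range_iff _).1 ⟨s, rfl⟩] at hs
    have hr0 : r ≠ 0 := by rcases hr with rfl | rfl <;> positivity
    exact_mod_cast mul_right_cancel₀ hr0 hs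
  rw [pairing_apply]
  push_cast
  symm
  refine Fintype.sum_of_injective e he.injective _ _ (fun i hi => ?_) fun s => ?_
  · exact Finset.sum_eq_zero fun j _ => hzero i j fun hij => hi ((he.mem_range_iff i).2 hij.1)
  · refine Fintype.sum_of_injective e he.injective _ _ (fun j hj => ?_) fun t => ?_
    · exact hzero _ j fun hij => hj ((he.mem_range_iff j).2 hij.2)
    · rw [hcoord, he.entry]

/-- If there is only one simple root of some length, roots of this length pair evenly. -/
theorem pairing_ne_neg_one {A : GCM ι} (hD : A.IsSymmetrizedBy D) {d : ℚ} (hpos : 0 < d)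
    (hval : ∀ i, D i = d ∨ D i = 2 * d) {r : ℚ} (hr : r = d ∨ r = 2 * d)
    {e : Fin 1 → ι} (he : A.IsLengthDiagram D r diagA1 e)
    {b b' : RootLattice ι} {c c' : CorootLattice ι}
    (h : A.IsRootPair D r b c) (h' : A.IsRootPair D r b' c') : A.pairing c b' ≠ -1 := by
  intro hp
  have hm := pairing_mod_two hD hpos hval hr he h h'
  rw [hp] at hm
  have h2 : (2 : ZMod 2) = 0 := rfl
  simp [diagA1, h2] at hm

/-- The Plücker relation modulo `2` for four roots of a length whose simple roots form a diagram
of type `A₂`. -/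
theorem pairing_pluecker {A : GCM ι} (hD : A.IsSymmetrizedBy D) {d : ℚ} (hpos : 0 < d)
    (hval : ∀ i, D i = d ∨ D i = 2 * d) {r : ℚ} (hr : r = d ∨ r = 2 * d)
    {e : Fin 2 → ι} (he : A.IsLengthDiagram D r diagA2 e)
    {b₁ b₂ b₃ b₄ : RootLattice ι} {c₁ c₂ c₃ c₄ : CorootLattice ι}
    (h₁ : A.IsRootPair D r b₁ c₁) (h₂ : A.IsRootPair D r b₂ c₂)
    (h₃ : A.IsRootPair D r b₃ c₃) (h₄ : A.IsRootPair D r b₄ c₄) :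
    ((A.pairing c₁ b₂ * A.pairing c₃ b₄ + A.pairing c₁ b₃ * A.pairing c₂ b₄
      + A.pairing c₁ b₄ * A.pairing c₂ b₃ : ℤ) : ZMod 2) = 0 := by
  -- Modulo 2 the matrix of `A₂` is the swap matrix, so the form is a determinant up to sign.
  have key : ∀ {b b' : RootLattice ι} {c c' : CorootLattice ι}, A.IsRootPair D r b c →
      A.IsRootPair D r b' c' → (A.pairing c b' : ZMod 2) =
        (b (e 0) : ZMod 2) * b' (e 1) + (b (e 1) : ZMod 2) * b' (e 0) := fun h h' => by
    rw [pairing_mod_two hD hpos hval hr he h h']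
    have h2 : (2 : ZMod 2) = 0 := rfl
    simp [Fin.sum_univ_two, diagA2, h2]
  push_cast
  rw [key h₁ h₂, key h₃ h₄, key h₁ h₃, key h₂ h₄, key h₁ h₄, key h₂ h₃]
  have h2 : (2 : ZMod 2) = 0 := rfl
  generalize (b₁ (e 0) : ZMod 2) = x₁, (b₁ (e 1) : ZMod 2) = y₁, (b₂ (e 0) : ZMod 2) = x₂,
    (b₂ (e 1) : ZMod 2) = y₂, (b₃ (e 0) : ZMod 2) = x₃, (b₃ (e 1) : ZMod 2) = y₃,
    (b₄ (e 0) : ZMod 2) = x₄, (b₄ (e 1) : ZMod 2) = y₄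
  -- Each of these six monomials occurs exactly twice in the expansion.
  linear_combination (x₁ * y₂ * x₃ * y₄ + x₁ * y₂ * y₃ * x₄ + y₁ * x₂ * x₃ * y₄
    + y₁ * x₂ * y₃ * x₄ + x₁ * x₂ * y₃ * y₄ + y₁ * y₂ * x₃ * x₄) * h2

/-- Every root of a length whose simple roots form a diagram of type `A₂` pairs to `-1` with some
root of the same length. -/
theorem IsRootPair.exists_pairing_eq_neg_one {A : GCM ι} {r : ℚ} {e : Fin 2 → ι}
    (he : A.IsLengthDiagram D r diagA2 e) {b : RootLattice ι} {c : CorootLattice ι}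
    (h : A.IsRootPair D r b c) :
    ∃ b' c', A.IsRootPair D r b' c' ∧ A.pairing c b' = -1 := by
  obtain ⟨w, hw, k, hk, rfl, rfl⟩ := h
  obtain ⟨s, rfl⟩ := (he.mem_range_iff k).2 hk
  -- In `Fin 2`, `1 - s` is the other vertex of `A₂`; the same `w` carries its simple root to the
  -- partner.
  refine ⟨_, _, ⟨w, hw, e (1 - s), (he.mem_range_iff _).1 ⟨_, rfl⟩, rfl, rfl⟩, ?_⟩
  rw [pairing_weylGroup A hw, pairing_simple, he.entry]
  fin_cases s <;> rfl

/-- There are no four roots of a length whose simple roots form a diagram of type `A₂` that form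
a chain of type `A₄`. -/
theorem not_chain_four {A : GCM ι} (hD : A.IsSymmetrizedBy D) {d : ℚ} (hpos : 0 < d)
    (hval : ∀ i, D i = d ∨ D i = 2 * d) {r : ℚ} (hr : r = d ∨ r = 2 * d)
    {e : Fin 2 → ι} (he : A.IsLengthDiagram D r diagA2 e)
    {b₁ b₂ b₃ b₄ : RootLattice ι} {c₁ c₂ c₃ c₄ : CorootLattice ι}
    (h₁ : A.IsRootPair D r b₁ c₁) (h₂ : A.IsRootPair D r b₂ c₂)
    (h₃ : A.IsRootPair D r b₃ c₃) (h₄ : A.IsRootPair D r b₄ c₄)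
    (h₁₂ : A.pairing c₁ b₂ = -1) (h₃₄ : A.pairing c₃ b₄ = -1)
    (h₁₃ : A.pairing c₁ b₃ = 0) (h₁₄ : A.pairing c₁ b₄ = 0) : False := by
  have := pairing_pluecker hD hpos hval hr he h₁ h₂ h₃ h₄
  simp [h₁₂, h₃₄, h₁₃, h₁₄] at this

/-- A root of a length whose simple roots form a diagram of type `A₂` is not orthogonal to two
joined roots of this length. -/
theorem not_orthogonal_edge {A : GCM ι} (hD : A.IsSymmetrizedBy D) {d : ℚ} (hpos : 0 < d)
    (hval : ∀ i, D i = d ∨ D i = 2 * d) {r : ℚ} (hr : r = d ∨ r = 2 * d)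
    {e : Fin 2 → ι} (he : A.IsLengthDiagram D r diagA2 e)
    {b₁ b₂ b₃ : RootLattice ι} {c₁ c₂ c₃ : CorootLattice ι}
    (h₁ : A.IsRootPair D r b₁ c₁) (h₂ : A.IsRootPair D r b₂ c₂) (h₃ : A.IsRootPair D r b₃ c₃)
    (h₁₂ : A.pairing c₁ b₂ = -1) (h₁₃ : A.pairing c₁ b₃ = 0)
    (h₂₃ : A.pairing c₂ b₃ = 0) : False := by
  -- The partner `b₄` witnesses that `b₃` is nonzero modulo 2; only the product of the pairings 12
  -- and 34 survives in the Plücker relation, and it is 1.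
  obtain ⟨b₄, c₄, h₄, h₃₄⟩ := h₃.exists_pairing_eq_neg_one he
  have := pairing_pluecker hD hpos hval hr he h₁ h₂ h₃ h₄
  simp [h₁₂, h₃₄, h₁₃, h₂₃] at this

/-! ### Edges and root lengths -/

/-- A double edge joins a shorter root, towards which it points, to a longer one. -/
theorem values_of_double_edge {A : GCM ι} (hD : A.IsSymmetrizedBy D) {d : ℚ} (hpos : 0 < d)
    (hval : ∀ i, D i = d ∨ D i = 2 * d) {k l : ι} {b b' : RootLattice ι} {c c' : CorootLattice ι}
    (h : A.IsRootPair D (D k) b c) (h' : A.IsRootPair D (D l) b' c')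
    (hcb : A.pairing c b' = -2) (hbc : A.pairing c' b = -1) : D k = d ∧ D l = 2 * d := by
  have hs := h.mul_pairing_comm hD h'
  rw [hcb, hbc] at hs
  push_cast at hs
  rcases hval k with hk | hk <;> rcases hval l with hl | hl <;> constructor <;> linarith

/-- Roots joined by a single edge have the same length. -/
theorem value_eq_of_single_edge {A : GCM ι} (hD : A.IsSymmetrizedBy D)
    {r r' : ℚ} {b b' : RootLattice ι} {c c' : CorootLattice ι}
    (h : A.IsRootPair D r b c) (h' : A.IsRootPair D r' b' c')
    (hcb : A.pairing c b' = -1) (hbc : A.pairing c' b = -1) : r = r' := by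
  have hs := h.mul_pairing_comm hD h'
  rw [hcb, hbc] at hs
  push_cast at hs
  linarith

end GCM

end KacMoody

/-! ### Exclusion of the subdiagrams -/

theorem proposition5p8 {ι κ 𝔥 : Type*} [Fintype ι] [DecidableEq ι] [AddCommGroup 𝔥] [Module ℂ 𝔥]
    (A : KacMoody.GCM ι) (R : KacMoody.Realization A 𝔥)
    (D : ι → ℚ) (hD : A.IsSymmetrizedBy D)
    (hlaced : A.DoublyLaced) (htwo : A.HasExactlyTwoRootLengths D)
    (β : κ → KacMoody.RootLattice ι) (hβ : R.IsPiSystem β) (hlin : LinearIndependent ℤ β) :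
    (A.SubdiagramOnIsOfType (A.shortVertices D) KacMoody.diagA1 →
      ¬ KacMoody.IsSubdiagram KacMoody.diagC3 (A.typeOf β)) ∧
    (A.SubdiagramOnIsOfType (A.longVertices D) KacMoody.diagA1 →
      ¬ KacMoody.IsSubdiagram KacMoody.diagB3 (A.typeOf β)) ∧
    (A.SubdiagramOnIsOfType (A.shortVertices D) KacMoody.diagA2 →
      ¬ KacMoody.IsSubdiagram KacMoody.diagC5 (A.typeOf β) ∧
      ¬ KacMoody.IsSubdiagram KacMoody.diagHD3_2 (A.typeOf β)) ∧
    (A.SubdiagramOnIsOfType (A.longVertices D) KacMoody.diagA2 →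
      ¬ KacMoody.IsSubdiagram KacMoody.diagB5 (A.typeOf β) ∧
      ¬ KacMoody.IsSubdiagram KacMoody.diagHC2_1 (A.typeOf β)) := by

  obtain ⟨d, hpos, hshort, hlong, hval⟩ := KacMoody.GCM.exists_symmetrizer_values hD hlaced htwo
  choose k hk using fun i => A.exists_isRootPair_coroot (D := D) (hβ.real i)
  have single : ∀ {i j}, A.typeOf β i j = -1 → A.typeOf β j i = -1 → D (k i) = D (k j) :=
    fun h h' => KacMoody.GCM.value_eq_of_single_edge hD (hk _) (hk _) h h'
  have double : ∀ {i j}, A.typeOf β i j = -2 → A.typeOf β j i = -1 →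
      D (k i) = d ∧ D (k j) = 2 * d :=
    fun h h' => KacMoody.GCM.values_of_double_edge hD hpos hval (hk _) (hk _) h h'
  have pair : ∀ {i r}, D (k i) = r → A.IsRootPair D r (β i) (A.coroot (β i)) :=
    fun h => h ▸ hk _
  have hS := A.mem_shortVertices_iff hpos hshort hval
  have hL := A.mem_longVertices_iff hpos hlong hval
  refine ⟨fun hX => ?_, fun hX => ?_, fun hX => ?_, fun hX => ?_⟩
  · rintro ⟨f, hf⟩
    obtain ⟨e, he⟩ := hX.exists_isLengthDiagram hS
    have h1 := (double (hf 1 2) (hf 2 1)).1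
    have h0 := (single (hf 0 1) (hf 1 0)).trans h1
    exact KacMoody.GCM.pairing_ne_neg_one hD hpos hval (.inl rfl) he (pair h0) (pair h1) (hf 0 1)
  · rintro ⟨f, hf⟩
    obtain ⟨e, he⟩ := hX.exists_isLengthDiagram hL
    have h1 := (double (hf 2 1) (hf 1 2)).2
    have h0 := (single (hf 0 1) (hf 1 0)).trans h1
    exact KacMoody.GCM.pairing_ne_neg_one hD hpos hval (.inr rfl) he (pair h0) (pair h1) (hf 0 1)
  · obtain ⟨e, he⟩ := hX.exists_isLengthDiagram hS
    constructor
    · rintro ⟨f, hf⟩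
      -- The double edge makes vertex 3 short, and shortness spreads along the single edges to an
      -- `A₄` chain.
      have h3 := (double (hf 3 4) (hf 4 3)).1
      have h2 := (single (hf 2 3) (hf 3 2)).trans h3
      have h1 := (single (hf 1 2) (hf 2 1)).trans h2
      have h0 := (single (hf 0 1) (hf 1 0)).trans h1
      exact KacMoody.GCM.not_chain_four hD hpos hval (.inl rfl) he (pair h0) (pair h1) (pair h2)
        (pair h3) (hf 0 1) (hf 2 3) (hf 0 2) (hf 0 3)
    · rintro ⟨f, hf⟩
      -- Vertices 0, 1, 3 are short; 3 is orthogonal to the edge between 0 and 1.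
      have h1 := (double (hf 1 2) (hf 2 1)).1
      have h0 := (single (hf 0 1) (hf 1 0)).trans h1
      have h3 := (double (hf 3 2) (hf 2 3)).1
      exact KacMoody.GCM.not_orthogonal_edge hD hpos hval (.inl rfl) he (pair h0) (pair h1)
        (pair h3) (hf 0 1) (hf 0 3) (hf 1 3)
  · obtain ⟨e, he⟩ := hX.exists_isLengthDiagram hL
    constructor
    · rintro ⟨f, hf⟩
      have h3 := (double (hf 4 3) (hf 3 4)).2
      have h2 := (single (hf 2 3) (hf 3 2)).trans h3
      have h1 := (single (hf 1 2) (hf 2 1)).trans h2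
      have h0 := (single (hf 0 1) (hf 1 0)).trans h1
      exact KacMoody.GCM.not_chain_four hD hpos hval (.inr rfl) he (pair h0) (pair h1) (pair h2)
        (pair h3) (hf 0 1) (hf 2 3) (hf 0 2) (hf 0 3)
    · rintro ⟨f, hf⟩
      -- Dually, vertices 0, 1, 3 are long and only vertex 2 is short.
      have h1 := (double (hf 2 1) (hf 1 2)).2
      have h0 := (single (hf 0 1) (hf 1 0)).trans h1
      have h3 := (double (hf 2 3) (hf 3 2)).2
      exact KacMoody.GCM.not_orthogonal_edge hD hpos hval (.inr rfl) he (pair h0) (pair h1)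
        (pair h3) (hf 0 1) (hf 0 3) (hf 1 3)
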